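/- Let $M\in\mathbb Z^{m\times n}$ and $b\in\mathbb Z^m$, and let $Q=\{x\in\mathbb R^n : Mx\le b\}$. A face of $Q$ is a set $\{x\in Q : w^\top x=\tau\}$ where $w\in\mathbb R^n$, $\tau\in\mathbb R$ and $w^\top x\le\tau$ holds for all $x\in Q$; a minimal face is an inclusion-minimal nonempty face. A polyhedron is integral if each of its minimal faces contains a vector of $\mathbb Z^n$. A constraint of $Mx\le b$ is tight for a set $S$ if it holds with equality at every point of $S$; the implicit equalities of $Mx\le b$ are the constraints that are tight for $Q$. The system $Mx\le b$ is - totally dual integral (TDI) if for every $w\in\mathbb Z^n$ for which the linear programs $\max\{w^\top x : Mx\le b\}$ and $\min\{b^\top y : M^\top y=w,\ y\ge 0\}$ have optimal solutions, the latter has an optimal solution in $\mathbb Z^m$; - non-degenerate if for every minimal face $F\neq Q$ of $Q$ the left-hand sides of the constraints tight for $F$ are linearly independent, where of two tight constraints of the form $\alpha^\top x\le\beta$ and $-\alpha^\top x\le-\beta$ only one is considered (that is, there is a set $J$ of constraints tight for $F$ whose left-hand sides are linearly independent such that every other constraint tight for $F$ is of the form $-\alpha^\top x\le-\beta$ for some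 constraint $\alpha^\top x\le\beta$ in $J$); - resilient if $Q$ is integral and, for every $i\in\{1,\dots,m\}$, the polyhedron $Q\cap\{x : \mathrm{row}_i(M)x\le b_i-1\}$ is integral. Vectors $a^1,\dots,a^k\in\mathbb Z^n$ form a Hilbert cone if every vector of $\mathbb Z^n$ in their conic hull is a combination of $a^1,\dots,a^k$ with nonnegative integer multipliers. **Theorem.** Suppose that $Q$ is nonempty and that $Mx\le b$ is non-degenerate. Then $Mx\le b$ is TDI if and only if both of the following hold: (i) the rows of $M$ that belong to the implicit equalities of $Mx\le b$ form a Hilbert cone; (ii) $Mx\le b$ is resilient. Moreover, if $Q$ is full-dimensional, then $Mx\le b$ is TDI if and only if it is resilient. -/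

import Mathlib

open scoped Matrix

noncomputable section

/-- The `i`-th row of an integral matrix, as a real vector. -/
def rowR {m n : ℕ} (M : Matrix (Fin m) (Fin n) ℤ) (i : Fin m) : Fin n → ℝ :=
  fun j => (M i j : ℝ)

/-- The polyhedron `{x ∈ ℝⁿ : M x ≤ b}`. -/
def polyhedron {m n : ℕ} (M : Matrix (Fin m) (Fin n) ℤ) (b : Fin m → ℤ) :
    Set (Fin n → ℝ) :=
  {x | ∀ i, rowR M i ⬝ᵥ x ≤ (b i : ℝ)}

/-! ### Linear programs and total dual integrality -/

/-- `x` is an optimal solution of the primal `max {wᵀ x : M x ≤ b}`. -/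
def IsPrimalOptimal {m n : ℕ} (M : Matrix (Fin m) (Fin n) ℤ) (b : Fin m → ℤ)
    (w : Fin n → ℝ) (x : Fin n → ℝ) : Prop :=
  x ∈ polyhedron M b ∧ ∀ x' ∈ polyhedron M b, w ⬝ᵥ x' ≤ w ⬝ᵥ x

/-- `y` is feasible for the dual `min {bᵀ y : Mᵀ y = w, y ≥ 0}`. -/
def IsDualFeasible {m n : ℕ} (M : Matrix (Fin m) (Fin n) ℤ)
    (w : Fin n → ℝ) (y : Fin m → ℝ) : Prop :=
  (∀ i, 0 ≤ y i) ∧ ∑ i, y i • rowR M i = w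

/-- `y` is an optimal solution of the dual `min {bᵀ y : Mᵀ y = w, y ≥ 0}`. -/
def IsDualOptimal {m n : ℕ} (M : Matrix (Fin m) (Fin n) ℤ) (b : Fin m → ℤ)
    (w : Fin n → ℝ) (y : Fin m → ℝ) : Prop :=
  IsDualFeasible M w y ∧
    ∀ y', IsDualFeasible M w y' → ∑ i, (b i : ℝ) * y i ≤ ∑ i, (b i : ℝ) * y' i

/-- `w` is admissible: both the primal and the dual have an optimal solution. -/
def IsAdmissible {m n : ℕ} (M : Matrix (Fin m) (Fin n) ℤ) (b : Fin m → ℤ)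
    (w : Fin n → ℝ) : Prop :=
  (∃ x, IsPrimalOptimal M b w x) ∧ ∃ y, IsDualOptimal M b w y

/-- `M x ≤ b` is totally dual integral: for every admissible integral `w`, the dual has an
integral optimal solution. -/
def IsTDI {m n : ℕ} (M : Matrix (Fin m) (Fin n) ℤ) (b : Fin m → ℤ) : Prop :=
  ∀ w : Fin n → ℤ, IsAdmissible M b (fun j => (w j : ℝ)) →
    ∃ y : Fin m → ℤ, IsDualOptimal M b (fun j => (w j : ℝ)) (fun i => (y i : ℝ))

/-! ### Faces, integrality, resilience -/

/-- `F` is a face of `Q`: the set of points of `Q` at which some inequality `wᵀ x ≤ τ` that is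
valid for `Q` holds with equality (`w = 0` is allowed, so `Q` is a face of itself). -/
def IsFace {n : ℕ} (Q F : Set (Fin n → ℝ)) : Prop :=
  ∃ (w : Fin n → ℝ) (τ : ℝ), (∀ x ∈ Q, w ⬝ᵥ x ≤ τ) ∧ F = {x ∈ Q | w ⬝ᵥ x = τ}

/-- `F` is a minimal face of `Q`: inclusion-minimal among the nonempty faces. -/
def IsMinimalFace {n : ℕ} (Q F : Set (Fin n → ℝ)) : Prop :=
  Minimal (fun G => IsFace Q G ∧ G.Nonempty) F

/-- A polyhedron is integral if each of its minimal faces contains an integral vector. -/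
def IsIntegralPolyhedron {n : ℕ} (Q : Set (Fin n → ℝ)) : Prop :=
  ∀ F, IsMinimalFace Q F → ∃ z : Fin n → ℤ, (fun j => (z j : ℝ)) ∈ F

/-- `M x ≤ b` is resilient: `Q = {x : M x ≤ b}` is integral, and so is
`Q ∩ {x : rowᵢ(M) x ≤ bᵢ - 1}` for every `i`. -/
def IsResilient {m n : ℕ} (M : Matrix (Fin m) (Fin n) ℤ) (b : Fin m → ℤ) : Prop :=
  IsIntegralPolyhedron (polyhedron M b) ∧
    ∀ i, IsIntegralPolyhedron (polyhedron M b ∩ {x | rowR M i ⬝ᵥ x ≤ (b i : ℝ) - 1})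

/-! ### Tight constraints, non-degeneracy, Hilbert cones -/

open Classical in
/-- The indices of the constraints of `M x ≤ b` that hold with equality on all of `S`. -/
def tightSet {m n : ℕ} (M : Matrix (Fin m) (Fin n) ℤ) (b : Fin m → ℤ)
    (S : Set (Fin n → ℝ)) : Finset (Fin m) :=
  Finset.univ.filter fun i => ∀ x ∈ S, rowR M i ⬝ᵥ x = (b i : ℝ)

/-- The indices of the implicit equalities of `M x ≤ b`. -/
def implicitEqualities {m n : ℕ} (M : Matrix (Fin m) (Fin n) ℤ) (b : Fin m → ℤ) :
    Finset (Fin m) :=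
  tightSet M b (polyhedron M b)

/-- `M x ≤ b` is non-degenerate: for every minimal proper face `F`, the left-hand sides of the
constraints tight for `F` are linearly independent, where of two tight constraints
`αᵀ x ≤ β` and `-αᵀ x ≤ -β` only one is considered (`J` is the set of constraints considered). -/
def IsNonDegenerate {m n : ℕ} (M : Matrix (Fin m) (Fin n) ℤ) (b : Fin m → ℤ) : Prop :=
  ∀ F, IsMinimalFace (polyhedron M b) F → F ≠ polyhedron M b →
    ∃ J : Finset (Fin m), J ⊆ tightSet M b F ∧
      LinearIndependent ℝ (fun i : J => rowR M i) ∧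
      ∀ i ∈ tightSet M b F, i ∉ J → ∃ j ∈ J, M i = -M j ∧ b i = -b j

/-- Finitely many integral vectors form a Hilbert cone: every integral vector in their conic hull
is a combination of them with nonnegative integral multipliers. -/
def IsHilbertCone {ι : Type*} [Fintype ι] {n : ℕ} (a : ι → Fin n → ℤ) : Prop :=
  ∀ w : Fin n → ℤ,
    (∃ c : ι → ℝ, (∀ i, 0 ≤ c i) ∧ ∀ j, (w j : ℝ) = ∑ i, c i * (a i j : ℝ)) →
    ∃ k : ι → ℕ, ∀ j, w j = ∑ i, (k i : ℤ) * a i j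

end

/-! Minimal faces are translates of the lineality space through basic points, where the tight rows
already determine all rows modulo that space (`isMinimalFace_polyhedron_iff`). Farkas' lemma and
complementary slackness turn TDI into a local condition: at every basic point, the tight rows form a
Hilbert cone (`IsTDI.isHilbertCone_tightSet`, `isTDI_of_forall_isHilbertCone_tightSet`).

If the system is TDI, the lattice generated by the tight rows is saturated, so tight equations with
integral right-hand sides that are solvable over the reals are solvable over the integers
(`IsHilbertCone.exists_int_dotProduct_eq`). This gives integrality of Q. A new basic point x of a
shifted polyhedron lies on a segment in Q ending at a basic point x' of Q with constraint i tight.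
Non-degeneracy at x' forces all rows tight at x' to be integral at x, so x can be replaced by an
integral point.

Conversely, at a basic point y, resilience yields an integral direction that lowers one tight row by
1 and keeps the others (`IsResilient.exists_int_dual`). Pairing it with an integral w in the cone
shows that the multiplier of that row is an integer. Only rows whose opposite is also tight escape
this argument; they are implicit equalities, handled by (i). -/

open scoped Matrix

/-! ### Cones and dual vectors -/

/-- **Farkas' lemma**. -/
theorem exists_nonneg_combination_of_dotProduct_nonpos {ι : Type*} {n : ℕ} (s : Finset ι)
    (a : ι → Fin n → ℝ) (w : Fin n → ℝ)
    (h : ∀ d, (∀ i ∈ s, a i ⬝ᵥ d ≤ 0) → w ⬝ᵥ d ≤ 0) :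
    ∃ c : ι → ℝ, (∀ i, 0 ≤ c i) ∧ ∑ i ∈ s, c i • a i = w := by
  classical
  induction s using Finset.induction_on generalizing a w with
  | empty =>
    refine ⟨0, fun _ => le_rfl, ?_⟩
    have := h w (by simp)
    simpa using (dotProduct_self_eq_zero.1 (le_antisymm this (by
      simpa using dotProduct_star_self_nonneg w))).symm
  | insert k s hk ih =>
    by_cases h' : ∀ d, (∀ i ∈ s, a i ⬝ᵥ d ≤ 0) → w ⬝ᵥ d ≤ 0
    · obtain ⟨c, hc, hw⟩ := ih a w h'
      refine ⟨Function.update c k 0, fun i => ?_, ?_⟩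
      · by_cases hi : i = k
        · subst hi; simp
        · simp [hi, hc]
      · rw [Finset.sum_insert hk, ← hw]
        simp only [Function.update_self, zero_smul, zero_add]
        exact Finset.sum_congr rfl fun i hi => by
          rw [Function.update_of_ne (ne_of_mem_of_not_mem hi hk)]
    · push Not at h'
      obtain ⟨d, hd, hwd⟩ := h'
      have hkd : 0 < a k ⬝ᵥ d := by
        by_contra hle
        exact absurd (h d (by simpa [Finset.forall_mem_insert] using ⟨not_lt.1 hle, hd⟩))
          (not_le.2 hwd)
      set t := a k ⬝ᵥ d with ht
      -- Project along `a k` onto the hyperplane orthogonal to `d`. Shifting a test vector `x` along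
      -- `d` until it is orthogonal to `a k` reduces the projected hypothesis to `h`.
      obtain ⟨c, hc, hw⟩ := ih (fun i => a i - ((a i ⬝ᵥ d) / t) • a k)
        (w - ((w ⬝ᵥ d) / t) • a k) (by
          intro x hx
          have key := h (x - ((a k ⬝ᵥ x) / t) • d) (by
            rw [Finset.forall_mem_insert]
            constructor
            · simp only [dotProduct_sub, dotProduct_smul, smul_eq_mul, ← ht]
              rw [div_mul_cancel₀ _ hkd.ne', sub_self]
            · intro i hi
              have := hx i hi
              simp only [sub_dotProduct, smul_dotProduct, dotProduct_sub, dotProduct_smul,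
                smul_eq_mul] at this ⊢
              convert this using 2
              ring)
          simp only [sub_dotProduct, smul_dotProduct, dotProduct_sub, dotProduct_smul,
            smul_eq_mul] at key ⊢
          convert key using 2
          ring)
      refine ⟨Function.update c k ((w ⬝ᵥ d) / t - ∑ i ∈ s, c i * ((a i ⬝ᵥ d) / t)),
        fun i => ?_, ?_⟩
      · by_cases hi : i = k
        · subst hi
          rw [Function.update_self, sub_nonneg]
          exact (Finset.sum_nonpos fun j hj => mul_nonpos_of_nonneg_of_nonpos (hc j)
            (div_nonpos_of_nonpos_of_nonneg (hd j hj) hkd.le)).trans (by positivity)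
        · simp [hi, hc]
      · rw [Finset.sum_insert hk, Function.update_self]
        have : ∑ i ∈ s, Function.update c k
            ((w ⬝ᵥ d) / t - ∑ i ∈ s, c i * ((a i ⬝ᵥ d) / t)) i • a i = ∑ i ∈ s, c i • a i :=
          Finset.sum_congr rfl fun i hi => by
            rw [Function.update_of_ne (ne_of_mem_of_not_mem hi hk)]
        rw [this, sub_smul, Finset.sum_smul]
        have e : ∑ i ∈ s, c i • (a i - ((a i ⬝ᵥ d) / t) • a k) =
            ∑ i ∈ s, c i • a i - ∑ i ∈ s, (c i * ((a i ⬝ᵥ d) / t)) • a k := by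
          rw [← Finset.sum_sub_distrib]
          exact Finset.sum_congr rfl fun i _ => by rw [smul_sub, smul_smul]
        rw [e, sub_eq_sub_iff_add_eq_add] at hw
        rw [sub_add_eq_add_sub, add_comm, hw, add_sub_cancel_right]

/-- A linearly independent family of vectors has dual vectors. -/
theorem LinearIndependent.exists_dotProduct_eq_single {ι : Type*} [DecidableEq ι] {n : ℕ}
    {v : ι → Fin n → ℝ} (hv : LinearIndependent ℝ v) (k : ι) :
    ∃ e : Fin n → ℝ, ∀ j, v j ⬝ᵥ e = if j = k then 1 else 0 := by
  obtain ⟨g, hg⟩ := LinearMap.exists_extend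
    ((Module.Basis.span hv).constr ℝ (fun j => if j = k then (1 : ℝ) else 0))
  refine ⟨fun j => g (Pi.single j 1), fun j => ?_⟩
  have h1 : g (v j) = if j = k then 1 else 0 := by
    have := LinearMap.congr_fun hg ((Module.Basis.span hv) j)
    rw [Module.Basis.constr_basis] at this
    simpa [Module.Basis.span_apply] using this
  rw [← h1, LinearMap.pi_apply_eq_sum_univ g (v j)]
  simp only [dotProduct, smul_eq_mul]
  refine Finset.sum_congr rfl fun i _ => ?_
  congr 2
  ext l
  simp [Pi.single_apply, eq_comm]

/-! ### Lattices generated by Hilbert cones -/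

/-- The integral lattice generated by a Hilbert cone is saturated. -/
theorem IsHilbertCone.mem_span_int {ι : Type*} [Fintype ι] {n : ℕ} {a : ι → Fin n → ℤ}
    (ha : IsHilbertCone a) {w : Fin n → ℤ} {c : ι → ℝ}
    (hc : ∀ j, (w j : ℝ) = ∑ i, c i * (a i j : ℝ)) :
    w ∈ Submodule.span ℤ (Set.range a) := by
  -- An integral shift makes all coefficients nonnegative, and is undone afterwards.
  obtain ⟨k, hk⟩ := ha (w + ∑ i, (⌈|c i|⌉) • a i) ⟨fun i => c i + ⌈|c i|⌉, fun i => by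
    have := Int.le_ceil |c i|
    have := neg_abs_le (c i)
    linarith, fun j => by
      simp [hc, add_mul, Finset.sum_add_distrib]⟩
  have : w = ∑ i, ((k i : ℤ) - ⌈|c i|⌉) • a i := by
    ext j
    have := hk j
    simp only [Pi.add_apply, Finset.sum_apply, Pi.smul_apply, smul_eq_mul] at this
    simp [sub_mul, Finset.sum_sub_distrib, ← this]
  rw [this]
  exact Submodule.sum_mem _ fun i _ => Submodule.smul_mem _ _ (Submodule.subset_span ⟨i, rfl⟩)

/-- If a linear system whose left-hand sides form a Hilbert cone has a real solution for an
integral right-hand side, then it has an integral solution. -/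
theorem IsHilbertCone.exists_int_dotProduct_eq {ι : Type*} [Fintype ι] {n : ℕ}
    {a : ι → Fin n → ℤ} (ha : IsHilbertCone a) (x : Fin n → ℝ)
    (hx : ∀ i, ∃ q : ℤ, (fun j => (a i j : ℝ)) ⬝ᵥ x = q) :
    ∃ z : Fin n → ℤ, ∀ i, (fun j => (a i j : ℝ)) ⬝ᵥ (fun j => (z j : ℝ)) =
      (fun j => (a i j : ℝ)) ⬝ᵥ x := by
  set N := Submodule.span ℤ (Set.range a) with hN
  have htf : Module.IsTorsionFree ℤ ((Fin n → ℤ) ⧸ N) := by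
    rw [Module.isTorsionFree_iff_smul_eq_zero]
    intro r q
    induction q using Submodule.Quotient.induction_on with | _ w
    rw [← Submodule.Quotient.mk_smul, Submodule.Quotient.mk_eq_zero,
      Submodule.Quotient.mk_eq_zero]
    refine fun h => or_iff_not_imp_left.2 fun hr => ?_
    rw [hN, Submodule.mem_span_range_iff_exists_fun] at h
    obtain ⟨c, hc⟩ := h
    refine ha.mem_span_int (c := fun i => (c i : ℝ) / r) fun j => ?_
    have := congrFun hc j
    simp only [Finset.sum_apply, Pi.smul_apply, smul_eq_mul] at this
    have hr' : (r : ℝ) ≠ 0 := by exact_mod_cast hr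
    have e : ∑ i, (c i : ℝ) / r * (a i j : ℝ) = (∑ i, (c i : ℝ) * (a i j : ℝ)) / r := by
      rw [Finset.sum_div]; exact Finset.sum_congr rfl fun i _ => by ring
    rw [e, eq_div_iff hr', mul_comm]
    exact_mod_cast this.symm
  -- The quotient is finitely generated and torsion-free over ℤ, hence projective, so `N` is a
  -- direct summand.
  obtain ⟨s, hs⟩ := Module.projective_lifting_property N.mkQ LinearMap.id N.mkQ_surjective
  have hp : ∀ w, w - s (N.mkQ w) ∈ N := fun w => by
    rw [← Submodule.Quotient.mk_eq_zero, ← Submodule.mkQ_apply, map_sub]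
    have := LinearMap.congr_fun hs (N.mkQ w)
    simp only [LinearMap.comp_apply, LinearMap.id_apply] at this
    rw [this, sub_self]
  have hint : ∀ w ∈ N, ∃ q : ℤ, (fun j => (w j : ℝ)) ⬝ᵥ x = q := by
    intro w hw
    induction hw using Submodule.span_induction with
    | mem w h => obtain ⟨i, rfl⟩ := h; exact hx i
    | zero => exact ⟨0, by simp [dotProduct]⟩
    | add u v _ _ hu hv =>
      obtain ⟨q, hq⟩ := hu
      obtain ⟨r, hr⟩ := hv
      refine ⟨q + r, ?_⟩
      push_cast
      rw [← hq, ← hr, ← add_dotProduct]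
      congr 1; ext j; simp
    | smul t u _ hu =>
      obtain ⟨q, hq⟩ := hu
      refine ⟨t * q, ?_⟩
      push_cast
      rw [← hq, ← smul_eq_mul, ← smul_dotProduct]
      congr 1; ext j; simp
  -- Pairing with `x` is integral on `N`; composed with the projection onto `N` it becomes a
  -- functional on all of ℤⁿ, and `z` is its coordinate vector.
  choose z hz using fun j => hint _ (hp (Pi.single j 1))
  refine ⟨z, fun i => ?_⟩
  have hai : a i ∈ N := Submodule.subset_span ⟨i, rfl⟩
  let p : (Fin n → ℤ) →ₗ[ℤ] (Fin n → ℤ) := LinearMap.id - s ∘ₗ N.mkQ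
  have hpa : p (a i) = a i := by
    have : N.mkQ (a i) = 0 := by simpa using hai
    simp [p, this]
  have hpz : ∀ j, (fun l => (p (Pi.single j 1) l : ℝ)) ⬝ᵥ x = z j := hz
  calc (fun j => (a i j : ℝ)) ⬝ᵥ (fun j => (z j : ℝ))
      = ∑ j, (a i j : ℝ) * ((fun l => (p (Pi.single j 1) l : ℝ)) ⬝ᵥ x) := by
        simp only [dotProduct]
        exact Finset.sum_congr rfl fun j _ => by rw [← hpz j]; rfl
    _ = (fun l => (p (a i) l : ℝ)) ⬝ᵥ x := by
        have : (fun l => (p (a i) l : ℝ)) =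
            ∑ j, (a i j : ℝ) • fun l => (p (Pi.single j 1) l : ℝ) := by
          ext l
          conv_lhs => rw [pi_eq_sum_univ' (a i)]
          simp only [map_sum, map_smul, Finset.sum_apply, Pi.smul_apply, smul_eq_mul]
          push_cast
          refine Finset.sum_congr rfl fun j _ => ?_
          congr 3
        rw [this, sum_dotProduct]
        simp [smul_dotProduct]
    _ = (fun j => (a i j : ℝ)) ⬝ᵥ x := by rw [hpa]

/-! ### Basic points and minimal faces -/

/-- A point of `{x : M x ≤ b}` at which the tight constraints have the same kernel as `M`. -/
def IsBasicPoint {m n : ℕ} (M : Matrix (Fin m) (Fin n) ℤ) (b : Fin m → ℤ)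
    (x : Fin n → ℝ) : Prop :=
  x ∈ polyhedron M b ∧ ∀ d : Fin n → ℝ,
    (∀ i, rowR M i ⬝ᵥ x = b i → rowR M i ⬝ᵥ d = 0) → ∀ i, rowR M i ⬝ᵥ d = 0

/-- Moving in a direction that is feasible at `x` but eventually leaves the polyhedron, one
stops at a point where a further constraint becomes tight. -/
theorem exists_pos_add_smul_mem_polyhedron {m n : ℕ} {M : Matrix (Fin m) (Fin n) ℤ}
    {b : Fin m → ℤ} {x d : Fin n → ℝ} (hx : x ∈ polyhedron M b)
    (hd : ∀ i, rowR M i ⬝ᵥ x = b i → rowR M i ⬝ᵥ d ≤ 0) (hk : ∃ k, 0 < rowR M k ⬝ᵥ d) :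
    ∃ t : ℝ, 0 < t ∧ x + t • d ∈ polyhedron M b ∧
      ∃ k, 0 < rowR M k ⬝ᵥ d ∧ rowR M k ⬝ᵥ (x + t • d) = b k := by
  classical
  -- Ratio test: the first constraint met along `d` has the least quotient of slack by speed.
  obtain ⟨k, hk, hmin⟩ := Finset.exists_min_image
    (Finset.univ.filter fun k => 0 < rowR M k ⬝ᵥ d)
    (fun k => (b k - rowR M k ⬝ᵥ x) / (rowR M k ⬝ᵥ d)) (by
      obtain ⟨k, hk⟩ := hk
      exact ⟨k, by simpa using hk⟩)
  simp only [Finset.mem_filter, Finset.mem_univ, true_and] at hk hmin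
  have hlt : rowR M k ⬝ᵥ x < b k :=
    lt_of_le_of_ne (hx k) fun h => absurd (hd k h) (not_le.2 hk)
  have ht : 0 < (b k - rowR M k ⬝ᵥ x) / (rowR M k ⬝ᵥ d) := div_pos (sub_pos.2 hlt) hk
  refine ⟨_, ht, fun i => ?_, k, hk, ?_⟩
  · rw [dotProduct_add, dotProduct_smul, smul_eq_mul]
    by_cases hi : 0 < rowR M i ⬝ᵥ d
    · have := (le_div_iff₀ hi).1 (hmin i hi)
      linarith
    · have := mul_nonpos_of_nonneg_of_nonpos ht.le (not_lt.1 hi)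
      linarith [hx i]
  · rw [dotProduct_add, dotProduct_smul, smul_eq_mul, div_mul_cancel₀ _ hk.ne']
    ring

/-- A linear function that attains its maximum at `x` does not increase along directions that
are feasible at `x`. -/
theorem dotProduct_nonpos_of_isMaxOn {m n : ℕ} {M : Matrix (Fin m) (Fin n) ℤ} {b : Fin m → ℤ}
    {w x d : Fin n → ℝ} (hx : x ∈ polyhedron M b)
    (hw : ∀ y ∈ polyhedron M b, w ⬝ᵥ y ≤ w ⬝ᵥ x)
    (hd : ∀ i, rowR M i ⬝ᵥ x = b i → rowR M i ⬝ᵥ d ≤ 0) : w ⬝ᵥ d ≤ 0 := by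
  by_cases hk : ∃ k, 0 < rowR M k ⬝ᵥ d
  · obtain ⟨t, ht, hmem, -⟩ := exists_pos_add_smul_mem_polyhedron hx hd hk
    have := hw _ hmem
    rw [dotProduct_add, dotProduct_smul, smul_eq_mul] at this
    exact nonpos_of_mul_nonpos_right (by linarith) ht
  · push Not at hk
    have := hw (x + d) fun i => by
      rw [dotProduct_add]; linarith [hx i, hk i]
    rw [dotProduct_add] at this
    linarith

/-- A linear function that attains its maximum at `x` vanishes on the directions in which one
can move both ways. -/
theorem dotProduct_eq_zero_of_isMaxOn {m n : ℕ} {M : Matrix (Fin m) (Fin n) ℤ} {b : Fin m → ℤ}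
    {w x d : Fin n → ℝ} (hx : x ∈ polyhedron M b)
    (hw : ∀ y ∈ polyhedron M b, w ⬝ᵥ y ≤ w ⬝ᵥ x)
    (hd : ∀ i, rowR M i ⬝ᵥ x = b i → rowR M i ⬝ᵥ d = 0) : w ⬝ᵥ d = 0 := by
  refine le_antisymm (dotProduct_nonpos_of_isMaxOn hx hw fun i hi => (hd i hi).le) ?_
  have := dotProduct_nonpos_of_isMaxOn (d := -d) hx hw fun i hi => by simp [hd i hi]
  rw [dotProduct_neg] at this
  linarith

/-- The maximum of a linear function over a polyhedron is attained at a basic point. -/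
theorem exists_isBasicPoint {m n : ℕ} {M : Matrix (Fin m) (Fin n) ℤ} {b : Fin m → ℤ}
    {w x : Fin n → ℝ} (hx : x ∈ polyhedron M b)
    (hw : ∀ y ∈ polyhedron M b, w ⬝ᵥ y ≤ w ⬝ᵥ x) :
    ∃ y, IsBasicPoint M b y ∧ w ⬝ᵥ y = w ⬝ᵥ x := by
  classical
  -- Each move keeps the tight constraints and gains one.
  induction hc : (Finset.univ.filter fun i => rowR M i ⬝ᵥ x ≠ b i).card using Nat.strong_induction_on
    generalizing x with | _ c ih
  by_cases hb : IsBasicPoint M b x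
  · exact ⟨x, hb, rfl⟩
  obtain ⟨d, hd, k, hk⟩ : ∃ d : Fin n → ℝ, (∀ i, rowR M i ⬝ᵥ x = b i → rowR M i ⬝ᵥ d = 0) ∧
      ∃ k, 0 < rowR M k ⬝ᵥ d := by
    simp only [IsBasicPoint, hx, true_and] at hb
    push Not at hb
    obtain ⟨d, hd, k, hk⟩ := hb
    rcases lt_or_gt_of_ne hk with hk | hk
    · exact ⟨-d, fun i hi => by simp [hd i hi], k, by simpa using hk⟩
    · exact ⟨d, hd, k, hk⟩
  obtain ⟨t, ht, hmem, l, hl, hlt⟩ :=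
    exists_pos_add_smul_mem_polyhedron hx (fun i hi => (hd i hi).le) ⟨k, hk⟩
  have hwd := dotProduct_eq_zero_of_isMaxOn hx hw hd
  have hwt : w ⬝ᵥ (x + t • d) = w ⬝ᵥ x := by simp [dotProduct_add, hwd]
  have htight : ∀ i, rowR M i ⬝ᵥ x = b i → rowR M i ⬝ᵥ (x + t • d) = b i := fun i hi => by
    simp [dotProduct_add, hd i hi, hi]
  obtain ⟨y, hy, hyw⟩ := ih _ (by
    rw [← hc]
    refine Finset.card_lt_card (Finset.ssubset_iff_subset_ne.2 ⟨fun i => ?_, fun h => ?_⟩)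
    · simp only [Finset.mem_filter, Finset.mem_univ, true_and]
      exact fun h h' => h (htight i h')
    · have : l ∉ Finset.univ.filter fun i => rowR M i ⬝ᵥ x ≠ b i := by
        rw [← h, Finset.mem_filter]; exact fun h => h.2 hlt
      simp only [Finset.mem_filter, Finset.mem_univ, true_and, not_not] at this
      exact hl.ne' (hd l this)) hmem (fun y hy => (hw y hy).trans hwt.ge) rfl
  exact ⟨y, hy, hyw.trans hwt⟩

theorem mem_polyhedron_of_forall_dotProduct_eq {m n : ℕ} {M : Matrix (Fin m) (Fin n) ℤ}
    {b : Fin m → ℤ} {x y : Fin n → ℝ} (hx : x ∈ polyhedron M b)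
    (hy : ∀ i, rowR M i ⬝ᵥ y = rowR M i ⬝ᵥ x) : y ∈ polyhedron M b :=
  fun i => (hy i).trans_le (hx i)

theorem IsBasicPoint.forall_dotProduct_eq {m n : ℕ} {M : Matrix (Fin m) (Fin n) ℤ}
    {b : Fin m → ℤ} {x y : Fin n → ℝ} (hx : IsBasicPoint M b x)
    (hy : ∀ i, rowR M i ⬝ᵥ x = b i → rowR M i ⬝ᵥ y = b i) (i : Fin m) :
    rowR M i ⬝ᵥ y = rowR M i ⬝ᵥ x := by
  have := hx.2 (y - x) (fun i hi => by rw [dotProduct_sub, hy i hi, hi, sub_self]) i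
  rwa [dotProduct_sub, sub_eq_zero] at this

/-- The minimal faces of a polyhedron are the translates of its lineality space through its
basic points. -/
theorem isMinimalFace_polyhedron_iff {m n : ℕ} {M : Matrix (Fin m) (Fin n) ℤ} {b : Fin m → ℤ}
    {F : Set (Fin n → ℝ)} :
    IsMinimalFace (polyhedron M b) F ↔
      ∃ x, IsBasicPoint M b x ∧ F = {y | ∀ i, rowR M i ⬝ᵥ y = rowR M i ⬝ᵥ x} := by
  classical
  have const : ∀ w x y : Fin n → ℝ, x ∈ polyhedron M b →
      (∀ y ∈ polyhedron M b, w ⬝ᵥ y ≤ w ⬝ᵥ x) →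
      (∀ i, rowR M i ⬝ᵥ y = rowR M i ⬝ᵥ x) → w ⬝ᵥ y = w ⬝ᵥ x := by
    intro w x y hx hw hy
    have := dotProduct_eq_zero_of_isMaxOn (d := y - x) hx hw
      fun i _ => by rw [dotProduct_sub, hy, sub_self]
    rwa [dotProduct_sub, sub_eq_zero] at this
  have face : ∀ x, IsBasicPoint M b x →
      IsFace (polyhedron M b) {y | ∀ i, rowR M i ⬝ᵥ y = rowR M i ⬝ᵥ x} := by
    intro x hx
    set T := Finset.univ.filter fun i => rowR M i ⬝ᵥ x = b i with hT
    -- The sum of the constraints tight at `x` exposes the face: equality in the sum forces equality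
    -- in each.
    refine ⟨∑ i ∈ T, rowR M i, ∑ i ∈ T, (b i : ℝ), fun y hy => ?_, ?_⟩
    · rw [sum_dotProduct]
      exact Finset.sum_le_sum fun i _ => hy i
    · ext y
      simp only [Set.mem_ofPred_eq, sum_dotProduct]
      constructor
      · intro hy
        exact ⟨mem_polyhedron_of_forall_dotProduct_eq hx.1 hy,
          Finset.sum_congr rfl fun i hi => (hy i).trans (Finset.mem_filter.1 hi).2⟩
      · rintro ⟨hy, hs⟩
        rw [Finset.sum_eq_sum_iff_of_le fun i _ => hy i] at hs
        exact hx.forall_dotProduct_eq fun i hi => hs i (by simp [hT, hi])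
  constructor
  · rintro ⟨⟨⟨w, τ, hw, rfl⟩, x, hx, hxτ⟩, hmin⟩
    obtain ⟨y, hy, hyw⟩ := exists_isBasicPoint hx fun y hy => (hw y hy).trans hxτ.ge
    have hyτ := hyw.trans hxτ
    have hle : {z | ∀ i, rowR M i ⬝ᵥ z = rowR M i ⬝ᵥ y} ⊆ {x ∈ polyhedron M b | w ⬝ᵥ x = τ} :=
      fun z hz => ⟨mem_polyhedron_of_forall_dotProduct_eq hy.1 hz,
        (const w y z hy.1 (fun u hu => (hw u hu).trans hyτ.ge) hz).trans hyτ⟩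
    exact ⟨y, hy, (hmin ⟨face y hy, y, fun _ => rfl⟩ hle).antisymm hle⟩
  · rintro ⟨x, hx, rfl⟩
    refine ⟨⟨face x hx, x, fun _ => rfl⟩, ?_⟩
    rintro G ⟨⟨w, τ, hw, rfl⟩, y, hy, hyτ⟩ hG z hz
    have hyx := hG ⟨hy, hyτ⟩
    exact ⟨mem_polyhedron_of_forall_dotProduct_eq hx.1 hz,
      (const w y z hy (fun u hu => (hw u hu).trans hyτ.ge)
        fun i => (hz i).trans (hyx i).symm).trans hyτ⟩

theorem isIntegralPolyhedron_polyhedron_iff {m n : ℕ} {M : Matrix (Fin m) (Fin n) ℤ}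
    {b : Fin m → ℤ} :
    IsIntegralPolyhedron (polyhedron M b) ↔ ∀ x, IsBasicPoint M b x →
      ∃ z : Fin n → ℤ, ∀ i, rowR M i ⬝ᵥ (fun j => (z j : ℝ)) = rowR M i ⬝ᵥ x := by
  constructor
  · exact fun h x hx => h _ (isMinimalFace_polyhedron_iff.2 ⟨x, hx, rfl⟩)
  · intro h F hF
    obtain ⟨x, hx, rfl⟩ := isMinimalFace_polyhedron_iff.1 hF
    exact h x hx

/-- Makes the basic-point description of minimal faces available for the shifted polyhedra in
resilience. -/
theorem polyhedron_inter_eq_polyhedron_update {m n : ℕ} (M : Matrix (Fin m) (Fin n) ℤ)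
    (b : Fin m → ℤ) (i : Fin m) :
    polyhedron M b ∩ {x | rowR M i ⬝ᵥ x ≤ (b i : ℝ) - 1} =
      polyhedron M (Function.update b i (b i - 1)) := by
  ext x
  simp only [polyhedron, Set.mem_inter_iff, Set.mem_ofPred_eq]
  constructor
  · rintro ⟨h, hi⟩ k
    by_cases hk : k = i
    · subst hk; simpa using hi
    · simpa [hk] using h k
  · intro h
    have hi : rowR M i ⬝ᵥ x ≤ (b i : ℝ) - 1 := by simpa using h i
    refine ⟨fun k => ?_, hi⟩
    by_cases hk : k = i
    · subst hk; linarith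
    · simpa [hk] using h k

/-- The nondegeneracy condition at a basic point. -/
theorem IsNonDegenerate.exists_linearIndependent {m n : ℕ} {M : Matrix (Fin m) (Fin n) ℤ}
    {b : Fin m → ℤ} (h : IsNonDegenerate M b) {x x' : Fin n → ℝ} (hx : IsBasicPoint M b x)
    (hx' : x' ∈ polyhedron M b) (hne : ∃ i, rowR M i ⬝ᵥ x' ≠ rowR M i ⬝ᵥ x) :
    ∃ J : Finset (Fin m), (∀ i ∈ J, rowR M i ⬝ᵥ x = b i) ∧
      LinearIndependent ℝ (fun i : J => rowR M i) ∧
      ∀ i, rowR M i ⬝ᵥ x = b i → i ∉ J → ∃ j ∈ J, M i = -M j := by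
  obtain ⟨J, hJ, hli, hrest⟩ := h _ (isMinimalFace_polyhedron_iff.2 ⟨x, hx, rfl⟩) (by
    rintro h
    obtain ⟨i, hi⟩ := hne
    exact hi ((h.symm ▸ hx' : x' ∈ {y | ∀ i, rowR M i ⬝ᵥ y = rowR M i ⬝ᵥ x}) i))
  refine ⟨J, fun i hi => ?_, hli, fun i hi hiJ => ?_⟩
  · have := hJ hi
    simp only [tightSet, Finset.mem_filter, Finset.mem_univ, true_and] at this
    exact this x fun _ => rfl
  · obtain ⟨j, hj, hij, -⟩ := hrest i (by
      simp only [tightSet, Finset.mem_filter, Finset.mem_univ, true_and]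
      exact fun y hy => (hy i).trans hi) hiJ
    exact ⟨j, hj, hij⟩

theorem rowR_eq_neg {m n : ℕ} {M : Matrix (Fin m) (Fin n) ℤ} {i j : Fin m} (h : M i = -M j) :
    rowR M i = -rowR M j := by
  ext l
  simp [rowR, h]

theorem mem_tightSet {m n : ℕ} {M : Matrix (Fin m) (Fin n) ℤ} {b : Fin m → ℤ}
    {S : Set (Fin n → ℝ)} {i : Fin m} :
    i ∈ tightSet M b S ↔ ∀ x ∈ S, rowR M i ⬝ᵥ x = b i := by
  simp [tightSet]

theorem isHilbertCone_subtype_iff {m n : ℕ} {M : Matrix (Fin m) (Fin n) ℤ}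
    {S : Finset (Fin m)} :
    IsHilbertCone (fun i : S => M i) ↔ ∀ w : Fin n → ℤ,
      (∃ c : Fin m → ℝ, (∀ i, 0 ≤ c i) ∧ (∀ i ∉ S, c i = 0) ∧
        ∑ i, c i • rowR M i = fun j => (w j : ℝ)) →
      ∃ k : Fin m → ℕ, (∀ i ∉ S, k i = 0) ∧ ∑ i, (k i : ℤ) • M i = w := by
  classical
  constructor
  · rintro h w ⟨c, hc, hcS, hw⟩
    obtain ⟨k, hk⟩ := h w ⟨fun i => c i, fun i => hc i, fun j => by
      have := congrFun hw j
      rw [Finset.sum_coe_sort S (fun i => c i * (M i j : ℝ)), ← this, Finset.sum_apply]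
      exact (Finset.sum_subset (Finset.subset_univ S) fun i _ hi => by simp [hcS i hi]).symm⟩
    refine ⟨fun i => if hi : i ∈ S then k ⟨i, hi⟩ else 0, fun i hi => by simp [hi], ?_⟩
    ext j
    rw [hk, Finset.sum_apply, ← Finset.sum_subset (Finset.subset_univ S) fun i _ hi => by simp [hi],
      ← Finset.sum_coe_sort S]
    exact Finset.sum_congr rfl fun i _ => by simp
  · rintro h w ⟨c, hc, hw⟩
    obtain ⟨k, hkS, hk⟩ := h w ⟨fun i => if hi : i ∈ S then c ⟨i, hi⟩ else 0, fun i => by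
      dsimp only
      split_ifs
      · exact hc _
      · exact le_rfl, fun i hi => by simp [hi], by
      ext j
      rw [hw, Finset.sum_apply,
        ← Finset.sum_subset (Finset.subset_univ S) fun i _ hi => by simp [hi],
        ← Finset.sum_coe_sort S]
      exact Finset.sum_congr rfl fun i _ => by simp [rowR]⟩
    refine ⟨fun i => k i, fun j => ?_⟩
    rw [← hk, Finset.sum_apply,
      ← Finset.sum_subset (Finset.subset_univ S) fun i _ hi => by simp [hkS i hi],
      ← Finset.sum_coe_sort S]
    rfl

/-! ### Duality and complementary slackness -/

theorem dotProduct_eq_sum_of_isDualFeasible {m n : ℕ} {M : Matrix (Fin m) (Fin n) ℤ}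
    {w : Fin n → ℝ} {y : Fin m → ℝ} (hy : IsDualFeasible M w y) (x : Fin n → ℝ) :
    w ⬝ᵥ x = ∑ i, (rowR M i ⬝ᵥ x) * y i := by
  rw [← hy.2, sum_dotProduct]
  exact Finset.sum_congr rfl fun i _ => by rw [smul_dotProduct, smul_eq_mul, mul_comm]

/-- Weak duality. -/
theorem dotProduct_le_of_isDualFeasible {m n : ℕ} {M : Matrix (Fin m) (Fin n) ℤ}
    {b : Fin m → ℤ} {w x : Fin n → ℝ} {y : Fin m → ℝ} (hx : x ∈ polyhedron M b)
    (hy : IsDualFeasible M w y) : w ⬝ᵥ x ≤ ∑ i, (b i : ℝ) * y i := by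
  rw [dotProduct_eq_sum_of_isDualFeasible hy]
  exact Finset.sum_le_sum fun i _ => mul_le_mul_of_nonneg_right (hx i) (hy.1 i)

theorem dotProduct_eq_iff_of_isDualFeasible {m n : ℕ} {M : Matrix (Fin m) (Fin n) ℤ}
    {b : Fin m → ℤ} {w x : Fin n → ℝ} {y : Fin m → ℝ} (hx : x ∈ polyhedron M b)
    (hy : IsDualFeasible M w y) :
    w ⬝ᵥ x = ∑ i, (b i : ℝ) * y i ↔ ∀ i, rowR M i ⬝ᵥ x ≠ b i → y i = 0 := by
  rw [dotProduct_eq_sum_of_isDualFeasible hy,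
    Finset.sum_eq_sum_iff_of_le fun i _ => mul_le_mul_of_nonneg_right (hx i) (hy.1 i)]
  simp only [Finset.mem_univ, true_imp_iff, mul_eq_mul_right_iff]
  exact forall_congr' fun i => or_iff_not_imp_left

theorem isDualOptimal_of_complementary {m n : ℕ} {M : Matrix (Fin m) (Fin n) ℤ}
    {b : Fin m → ℤ} {w x : Fin n → ℝ} {y : Fin m → ℝ} (hx : x ∈ polyhedron M b)
    (hy : IsDualFeasible M w y) (h : ∀ i, rowR M i ⬝ᵥ x ≠ b i → y i = 0) :
    IsDualOptimal M b w y :=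
  ⟨hy, fun _ hy' => ((dotProduct_eq_iff_of_isDualFeasible hx hy).2 h).ge.trans
    (dotProduct_le_of_isDualFeasible hx hy')⟩

/-! ### Consequences of total dual integrality -/

/-- The rows of a totally dual integral system that are tight for a set of solutions form a
Hilbert cone. -/
theorem IsTDI.isHilbertCone_tightSet {m n : ℕ} {M : Matrix (Fin m) (Fin n) ℤ} {b : Fin m → ℤ}
    (h : IsTDI M b) {S : Set (Fin n → ℝ)} (hS : S.Nonempty) (hSQ : S ⊆ polyhedron M b) :
    IsHilbertCone (fun i : tightSet M b S => M i) := by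
  rw [isHilbertCone_subtype_iff]
  rintro w ⟨c, hc, hcS, hw⟩
  have hfeas : IsDualFeasible M (fun j => (w j : ℝ)) c := ⟨hc, hw⟩
  have hslack : ∀ x ∈ S, ∀ i, rowR M i ⬝ᵥ x ≠ b i → c i = 0 := fun x hx i hi =>
    hcS i fun hmem => hi (mem_tightSet.1 hmem x hx)
  have hval : ∀ x ∈ S, (fun j => (w j : ℝ)) ⬝ᵥ x = ∑ i, (b i : ℝ) * c i := fun x hx =>
    (dotProduct_eq_iff_of_isDualFeasible (hSQ hx) hfeas).2 (hslack x hx)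
  obtain ⟨x₀, hx₀⟩ := hS
  obtain ⟨y, hy, hopt⟩ := h w ⟨⟨x₀, hSQ hx₀, fun x' hx' =>
    (dotProduct_le_of_isDualFeasible hx' hfeas).trans (hval x₀ hx₀).ge⟩, c,
    isDualOptimal_of_complementary (hSQ hx₀) hfeas (hslack x₀ hx₀)⟩
  have hynn : ∀ i, 0 ≤ y i := fun i => by
    have := hy.1 i
    dsimp only at this
    exact_mod_cast this
  refine ⟨fun i => (y i).toNat, fun i hi => ?_, ?_⟩
  · have : ¬ ∀ x ∈ S, rowR M i ⬝ᵥ x = b i := fun h' => hi (mem_tightSet.2 h')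
    push Not at this
    obtain ⟨x, hx, hxi⟩ := this
    have h0 := (dotProduct_eq_iff_of_isDualFeasible (hSQ hx) hy).1
      (le_antisymm (dotProduct_le_of_isDualFeasible (hSQ hx) hy)
        ((hopt c hfeas).trans (hval x hx).ge)) i hxi
    have : y i = 0 := by exact_mod_cast h0
    simp [this]
  · ext j
    have := congrFun hy.2 j
    simp only [Finset.sum_apply, Pi.smul_apply, smul_eq_mul, rowR] at this
    simp only [Finset.sum_apply, Pi.smul_apply, smul_eq_mul, Int.toNat_of_nonneg (hynn _)]
    exact_mod_cast this

/-- If the tight rows at a basic point `x` of the polyhedron form a Hilbert cone and take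
integral values at `x'`, then some integral point agrees with `x'` on all rows. -/
theorem IsBasicPoint.exists_int {m n : ℕ} {M : Matrix (Fin m) (Fin n) ℤ} {b : Fin m → ℤ}
    {x : Fin n → ℝ} (hx : IsBasicPoint M b x)
    (hH : IsHilbertCone (fun i : tightSet M b {x} => M i)) (x' : Fin n → ℝ)
    (hx' : ∀ i, rowR M i ⬝ᵥ x = b i → ∃ q : ℤ, rowR M i ⬝ᵥ x' = q) :
    ∃ z : Fin n → ℤ, ∀ i, rowR M i ⬝ᵥ (fun j => (z j : ℝ)) = rowR M i ⬝ᵥ x' := by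
  obtain ⟨z, hz⟩ := hH.exists_int_dotProduct_eq x' fun i =>
    hx' i (mem_tightSet.1 i.2 x rfl)
  refine ⟨z, fun i => ?_⟩
  have := hx.2 ((fun j => (z j : ℝ)) - x') (fun i hi => by
    rw [dotProduct_sub, sub_eq_zero]
    exact hz ⟨i, mem_tightSet.2 (by simpa using hi)⟩) i
  rwa [dotProduct_sub, sub_eq_zero] at this

theorem exists_int_dotProduct_eq {n : ℕ} (v w : Fin n → ℤ) :
    ∃ q : ℤ, (fun j => (v j : ℝ)) ⬝ᵥ (fun j => (w j : ℝ)) = q :=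
  ⟨v ⬝ᵥ w, by simp [dotProduct]⟩

theorem IsTDI.isIntegralPolyhedron {m n : ℕ} {M : Matrix (Fin m) (Fin n) ℤ} {b : Fin m → ℤ}
    (h : IsTDI M b) : IsIntegralPolyhedron (polyhedron M b) :=
  isIntegralPolyhedron_polyhedron_iff.2 fun x hx =>
    hx.exists_int (h.isHilbertCone_tightSet (Set.singleton_nonempty x)
      (Set.singleton_subset_iff.2 hx.1)) x fun i hi => ⟨b i, hi⟩

theorem IsTDI.isResilient {m n : ℕ} {M : Matrix (Fin m) (Fin n) ℤ} {b : Fin m → ℤ}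
    (h : IsTDI M b) (hnd : IsNonDegenerate M b) : IsResilient M b := by
  classical
  refine ⟨h.isIntegralPolyhedron, fun i => ?_⟩
  have hint := isIntegralPolyhedron_polyhedron_iff.1 h.isIntegralPolyhedron
  rw [polyhedron_inter_eq_polyhedron_update, isIntegralPolyhedron_polyhedron_iff]
  intro x hx
  obtain ⟨hxQ, hxi⟩ : x ∈ polyhedron M b ∩ {x | rowR M i ⬝ᵥ x ≤ (b i : ℝ) - 1} := by
    rw [polyhedron_inter_eq_polyhedron_update]; exact hx.1
  replace hxi : rowR M i ⬝ᵥ x ≤ (b i : ℝ) - 1 := hxi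
  by_cases hb : IsBasicPoint M b x
  · exact hint x hb
  -- the tight constraints of the shifted system are those of the original one and the `i`-th
  have hker : ∀ d : Fin n → ℝ, (∀ k, rowR M k ⬝ᵥ x = b k → rowR M k ⬝ᵥ d = 0) →
      rowR M i ⬝ᵥ d = 0 → ∀ k, rowR M k ⬝ᵥ d = 0 := fun d hd hdi => hx.2 d fun k hk => by
    by_cases hki : k = i
    · rwa [hki]
    · exact hd k (by simpa [hki] using hk)
  have hxi' : rowR M i ⬝ᵥ x = (b i : ℝ) - 1 := by
    by_contra hne
    refine hb ⟨hxQ, fun d hd => hx.2 d fun k hk => hd k ?_⟩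
    by_cases hki : k = i
    · subst hki
      exact absurd (by simpa using hk) hne
    · simpa [hki] using hk
  -- Modulo the lineality space, `d` spans the only free direction at `x`; following it leads to the
  -- basic point `x'`.
  obtain ⟨d, hd, hdi⟩ : ∃ d : Fin n → ℝ, (∀ k, rowR M k ⬝ᵥ x = b k → rowR M k ⬝ᵥ d = 0) ∧
      0 < rowR M i ⬝ᵥ d := by
    simp only [IsBasicPoint, hxQ, true_and] at hb
    push Not at hb
    obtain ⟨d, hd, k, hk⟩ := hb
    rcases lt_trichotomy (rowR M i ⬝ᵥ d) 0 with hlt | heq | hgt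
    · exact ⟨-d, fun i hi => by simp [hd i hi], by simpa using hlt⟩
    · exact absurd (hker d hd heq k) hk
    · exact ⟨d, hd, hgt⟩
  obtain ⟨t, ht, hmem, l, hl, hlt⟩ :=
    exists_pos_add_smul_mem_polyhedron hxQ (fun k hk => (hd k hk).le) ⟨i, hdi⟩
  set x' := x + t • d with hx'
  have hval : ∀ k, rowR M k ⬝ᵥ x' = rowR M k ⬝ᵥ x + t * rowR M k ⬝ᵥ d := fun k => by
    rw [hx', dotProduct_add, dotProduct_smul, smul_eq_mul]
  have htight : ∀ k, rowR M k ⬝ᵥ x = b k → rowR M k ⬝ᵥ x' = b k := fun k hk => by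
    rw [hval, hd k hk, mul_zero, add_zero, hk]
  have hbx' : IsBasicPoint M b x' := by
    refine ⟨hmem, fun e he => ?_⟩
    set α := rowR M i ⬝ᵥ e / rowR M i ⬝ᵥ d with hα
    have hL := hker (e - α • d) (fun k hk => by
      simp [dotProduct_sub, hd k hk, he k (htight k hk)]) (by
      rw [dotProduct_sub, dotProduct_smul, smul_eq_mul, hα, div_mul_cancel₀ _ hdi.ne', sub_self])
    have h0 : α = 0 := by
      have := hL l
      rw [dotProduct_sub, dotProduct_smul, he l hlt, zero_sub, neg_eq_zero, smul_eq_mul] at this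
      exact (mul_eq_zero.1 this).resolve_right hl.ne'
    simpa [h0] using hL
  -- The value is an integer in the interval (bᵢ - 1, bᵢ].
  have hxi'' : rowR M i ⬝ᵥ x' = b i := by
    obtain ⟨z, hz⟩ := hint x' hbx'
    obtain ⟨q, hq⟩ := exists_int_dotProduct_eq (M i) z
    have hq' : rowR M i ⬝ᵥ x' = q := (hz i).symm.trans hq
    have h1 := hmem i
    have h2 : (b i : ℝ) - 1 < rowR M i ⬝ᵥ x' := by
      rw [hval, hxi']
      have := mul_pos ht hdi
      linarith
    rw [hq'] at h1 h2 ⊢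
    have h3 : q ≤ b i := by exact_mod_cast h1
    have h4 : b i - 1 < q := by exact_mod_cast h2
    have : q = b i := by omega
    exact_mod_cast this
  obtain ⟨J, hJ, hli, hrest⟩ := hnd.exists_linearIndependent hbx' hxQ
    ⟨i, by rw [hxi', hxi'']; linarith⟩
  -- by linear independence, `J` has no elements other than those tight for `x`, `i`, and
  -- the negatives of these
  have hTint : ∀ k, rowR M k ⬝ᵥ x = b k ∨ k = i → ∃ q : ℤ, rowR M k ⬝ᵥ x = q := by
    rintro k (hk | rfl)
    · exact ⟨_, hk⟩
    · exact ⟨b k - 1, by rw [hxi']; push_cast; ring⟩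
  have hJint : ∀ k ∈ J, ∃ q : ℤ, rowR M k ⬝ᵥ x = q := by
    intro k hk
    by_contra hcon
    -- A row `k` with non-integral value is neither `i`, nor tight at `x`, nor opposite to such a
    -- row. Its dual vector `e` then kills all of those rows, hence every row by `hker`, including
    -- `k` itself.
    obtain ⟨e, he⟩ := hli.exists_dotProduct_eq_single ⟨k, hk⟩
    have he' : ∀ j ∈ J, j ≠ k → rowR M j ⬝ᵥ e = 0 := fun j hj hjk => by
      simpa [hjk] using he ⟨j, hj⟩
    have hek : rowR M k ⬝ᵥ e = 1 := by simpa using he ⟨k, hk⟩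
    have hT : ∀ j, rowR M j ⬝ᵥ x = b j ∨ j = i → rowR M j ⬝ᵥ e = 0 := by
      intro j hj
      by_cases hjJ : j ∈ J
      · exact he' j hjJ fun hjk => hcon (hTint k (hjk ▸ hj))
      · obtain ⟨l, hl, hjl⟩ := hrest j
          (hj.elim (htight j) (fun h => h ▸ hxi'')) hjJ
        have hjl' := rowR_eq_neg hjl
        rw [hjl', neg_dotProduct, neg_eq_zero]
        refine he' l hl fun hlk => hcon ?_
        obtain ⟨q, hq⟩ := hTint j hj
        refine ⟨-q, ?_⟩
        rw [hjl', hlk, neg_dotProduct] at hq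
        push_cast
        linarith
    have := hker e (fun j hj => hT j (Or.inl hj)) (hT i (Or.inr rfl)) k
    linarith
  refine hbx'.exists_int (h.isHilbertCone_tightSet (Set.singleton_nonempty x')
    (Set.singleton_subset_iff.2 hmem)) x fun k hk => ?_
  by_cases hkJ : k ∈ J
  · exact hJint k hkJ
  · obtain ⟨j, hj, hkj⟩ := hrest k hk hkJ
    obtain ⟨q, hq⟩ := hJint j hj
    exact ⟨-q, by rw [rowR_eq_neg hkj, neg_dotProduct, hq]; push_cast; rfl⟩

/-! ### From resilience to total dual integrality -/

/-- At a basic point `y` of a resilient system with linearly independent tight constraints, every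
tight constraint whose opposite is not tight has an integral dual vector. -/
theorem IsResilient.exists_int_dual {m n : ℕ} {M : Matrix (Fin m) (Fin n) ℤ} {b : Fin m → ℤ}
    (h : IsResilient M b) {y : Fin n → ℝ} (hy : IsBasicPoint M b y) {J : Finset (Fin m)}
    (hli : LinearIndependent ℝ (fun i : J => rowR M i))
    (hrest : ∀ i, rowR M i ⬝ᵥ y = b i → i ∉ J → ∃ j ∈ J, M i = -M j)
    (hJ : ∀ i ∈ J, rowR M i ⬝ᵥ y = b i)
    {k : Fin m} (hk : rowR M k ⬝ᵥ y = b k)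
    (hone : ∀ l, rowR M l ⬝ᵥ y = b l → M l ≠ -M k) :
    ∃ d : Fin n → ℤ, rowR M k ⬝ᵥ (fun j => (d j : ℝ)) = -1 ∧
      ∀ l, rowR M l ⬝ᵥ y = b l → l ≠ k → rowR M l ⬝ᵥ (fun j => (d j : ℝ)) = 0 := by
  classical
  have hkJ : k ∈ J := by
    by_contra hkJ
    obtain ⟨j, hj, hkj⟩ := hrest k hk hkJ
    exact hone j (hJ j hj) (by rw [hkj, neg_neg])
  obtain ⟨e, he⟩ : ∃ e : Fin n → ℝ, ∀ l, rowR M l ⬝ᵥ y = b l →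
      rowR M l ⬝ᵥ e = if l = k then -1 else 0 := by
    obtain ⟨e, he⟩ := hli.exists_dotProduct_eq_single ⟨k, hkJ⟩
    have he' : ∀ j ∈ J, j ≠ k → rowR M j ⬝ᵥ e = 0 := fun j hj hjk => by
      simpa [hjk] using he ⟨j, hj⟩
    have hek : rowR M k ⬝ᵥ e = 1 := by simpa using he ⟨k, hkJ⟩
    refine ⟨-e, fun l hl => ?_⟩
    rw [dotProduct_neg]
    split_ifs with hlk
    · rw [hlk, hek]
    · rw [neg_eq_zero]
      by_cases hlJ : l ∈ J
      · exact he' l hlJ hlk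
      · obtain ⟨j, hj, hlj⟩ := hrest l hl hlJ
        rw [rowR_eq_neg hlj, neg_dotProduct, neg_eq_zero]
        exact he' j hj fun hjk => hone l hl (hjk ▸ hlj)
  have hek : rowR M k ⬝ᵥ e = -1 := by simpa using he k hk
  have hle : ∀ l, rowR M l ⬝ᵥ y = b l → rowR M l ⬝ᵥ e ≤ 0 := fun l hl => by
    rw [he l hl]; split_ifs <;> norm_num
  -- If the ray from `y` along `e` leaves Q, it does so at a basic point `y + t • e`. Integrality
  -- there makes `t` a positive integer, so the unit step stays inside.
  have hmem : y + e ∈ polyhedron M b := by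
    by_cases hex : ∃ l, 0 < rowR M l ⬝ᵥ e
    · obtain ⟨t, ht, hmem, l, hl, hlt⟩ := exists_pos_add_smul_mem_polyhedron hy.1 hle hex
      have hval : ∀ i, rowR M i ⬝ᵥ (y + t • e) = rowR M i ⬝ᵥ y + t * rowR M i ⬝ᵥ e := fun i => by
        rw [dotProduct_add, dotProduct_smul, smul_eq_mul]
      have hb : IsBasicPoint M b (y + t • e) := by
        refine ⟨hmem, fun f hf => ?_⟩
        have hL := hy.2 (f + (rowR M k ⬝ᵥ f) • e) fun i hi => by
          rw [dotProduct_add, dotProduct_smul, smul_eq_mul, he i hi]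
          split_ifs with hik
          · rw [hik]; ring
          · rw [hf i (by rw [hval, he i hi, if_neg hik, mul_zero, add_zero, hi])]; ring
        have h0 : rowR M k ⬝ᵥ f = 0 := by
          have := hL l
          rw [dotProduct_add, dotProduct_smul, hf l hlt, zero_add, smul_eq_mul] at this
          exact (mul_eq_zero.1 this).resolve_right hl.ne'
        simpa [h0] using hL
      obtain ⟨z, hz⟩ := isIntegralPolyhedron_polyhedron_iff.1 h.1 _ hb
      obtain ⟨q, hq⟩ := exists_int_dotProduct_eq (M k) z
      have hq' : (b k : ℝ) - t = q := by
        have h1 := (hz k).symm.trans hq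
        rw [hval, hk, hek] at h1
        linarith
      have ht1 : 1 ≤ t := by
        have h1 : (q : ℝ) < b k := by linarith
        have h2 : q < b k := by exact_mod_cast h1
        have h3 : q + 1 ≤ b k := by omega
        have h4 : (q : ℝ) + 1 ≤ b k := by exact_mod_cast h3
        linarith
      intro i
      rw [dotProduct_add]
      have h1 := hmem i
      rw [hval] at h1
      by_cases hi : rowR M i ⬝ᵥ e ≤ 0
      · linarith [hy.1 i]
      · have := mul_le_mul_of_nonneg_right ht1 (not_le.1 hi).le
        linarith
    · push Not at hex
      intro i
      rw [dotProduct_add]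
      linarith [hy.1 i, hex i]
  obtain ⟨z₀, hz₀⟩ := isIntegralPolyhedron_polyhedron_iff.1 h.1 _ hy
  have h2 := h.2 k
  rw [polyhedron_inter_eq_polyhedron_update, isIntegralPolyhedron_polyhedron_iff] at h2
  -- Every constraint tight at `y` is tight at `y + e` in the shifted system, so `y + e` is basic
  -- there.
  obtain ⟨z₁, hz₁⟩ := h2 (y + e) ⟨by
    rw [← polyhedron_inter_eq_polyhedron_update]
    refine ⟨hmem, ?_⟩
    change rowR M k ⬝ᵥ (y + e) ≤ b k - 1
    rw [dotProduct_add, hk, hek]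
    linarith, fun f hf => hy.2 f fun i hi => hf i (by
      rw [dotProduct_add, hi, he i hi]
      split_ifs with hik
      · subst hik; simp; ring
      · simp [hik])⟩
  have hd : ∀ l, rowR M l ⬝ᵥ (fun j => ((z₁ - z₀) j : ℝ)) = rowR M l ⬝ᵥ e := fun l => by
    have : (fun j => (((z₁ - z₀) j : ℤ) : ℝ)) = (fun j => (z₁ j : ℝ)) - fun j => (z₀ j : ℝ) := by
      ext j; simp
    rw [this, dotProduct_sub, hz₁, hz₀, dotProduct_add, add_sub_cancel_left]
  exact ⟨z₁ - z₀, by rw [hd, hek], fun l hl hlk => by rw [hd, he l hl, if_neg hlk]⟩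

/-- Under resilience and nondegeneracy, if the rows of the implicit equalities form a Hilbert
cone, then so do the rows tight at any basic point. -/
theorem IsResilient.isHilbertCone_tightSet_singleton {m n : ℕ} {M : Matrix (Fin m) (Fin n) ℤ}
    {b : Fin m → ℤ} (h : IsResilient M b) (hnd : IsNonDegenerate M b)
    (hH : IsHilbertCone (fun i : implicitEqualities M b => M i)) {y : Fin n → ℝ}
    (hy : IsBasicPoint M b y) : IsHilbertCone (fun i : tightSet M b {y} => M i) := by
  classical
  rw [isHilbertCone_subtype_iff] at hH ⊢
  have hsub : ∀ {i}, i ∈ implicitEqualities M b → i ∈ tightSet M b {y} := fun hi =>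
    mem_tightSet.2 fun x hx => mem_tightSet.1 hi x (hx ▸ hy.1)
  rintro w ⟨c, hc, hcT, hw⟩
  have htight : ∀ {i}, i ∈ tightSet M b {y} ↔ rowR M i ⬝ᵥ y = b i := by simp [mem_tightSet]
  -- Here Q is its own minimal face, where non-degeneracy says nothing, but all tight constraints
  -- are implicit equalities.
  by_cases hQ : ∀ x ∈ polyhedron M b, ∀ i, rowR M i ⬝ᵥ x = rowR M i ⬝ᵥ y
  · obtain ⟨k, hk, hkw⟩ := hH w ⟨c, hc, fun i hi => hcT i fun hiT => hi
      (mem_tightSet.2 fun x hx => (hQ x hx i).trans (htight.1 hiT)), hw⟩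
    exact ⟨k, fun i hi => hk i fun hi' => hi (hsub hi'), hkw⟩
  push Not at hQ
  obtain ⟨x', hx', hne⟩ := hQ
  obtain ⟨J, hJ, hli, hrest⟩ := hnd.exists_linearIndependent hy hx' hne
  -- `T` is the set of tight constraints whose opposite is not tight
  set T := Finset.univ.filter fun k => rowR M k ⬝ᵥ y = b k ∧
    ∀ l, rowR M l ⬝ᵥ y = b l → M l ≠ -M k with hT
  have hcint : ∀ k ∈ T, ∃ q : ℕ, c k = q := by
    intro k hk
    obtain ⟨hk, hone⟩ := (Finset.mem_filter.1 hk).2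
    obtain ⟨d, hdk, hd⟩ := h.exists_int_dual hy hli hrest hJ hk hone
    obtain ⟨q, hq⟩ := exists_int_dotProduct_eq w d
    rw [← hw, sum_dotProduct, Finset.sum_eq_single k] at hq
    · rw [smul_dotProduct, hdk, smul_eq_mul, mul_neg_one] at hq
      have h0 : 0 ≤ -q := by
        have : (0 : ℝ) ≤ -q := by rw [← hq, neg_neg]; exact hc k
        exact_mod_cast this
      refine ⟨(-q).toNat, ?_⟩
      have : (((-q).toNat : ℤ) : ℝ) = ((-q : ℤ) : ℝ) := by rw [Int.toNat_of_nonneg h0]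
      rw [Int.cast_natCast] at this
      rw [this, Int.cast_neg, ← hq, neg_neg]
    · intro l _ hlk
      by_cases hl : rowR M l ⬝ᵥ y = b l
      · rw [smul_dotProduct, hd l hl hlk, smul_zero]
      · rw [hcT l fun hl' => hl (htight.1 hl'), zero_smul, zero_dotProduct]
    · simp
  choose! q hq using hcint
  have himpl : ∀ k, rowR M k ⬝ᵥ y = b k → k ∉ T → k ∈ implicitEqualities M b := by
    intro k hk hkT
    simp only [hT, Finset.mem_filter, Finset.mem_univ, true_and, hk] at hkT
    push Not at hkT
    obtain ⟨l, hl, hlk⟩ := hkT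
    refine mem_tightSet.2 fun x hx => le_antisymm (hx k) ?_
    have h1 := hx l
    rw [← hl, rowR_eq_neg hlk, neg_dotProduct, neg_dotProduct, hk] at h1
    linarith
  -- Removing the integral part carried by `T` leaves an integral vector in the cone of the implicit
  -- equalities.
  obtain ⟨k, hk, hkw⟩ := hH (w - ∑ i ∈ T, (q i : ℤ) • M i)
    ⟨fun i => if i ∈ T then 0 else c i, fun i => by
      dsimp only
      split_ifs
      · exact le_rfl
      · exact hc i, fun i hi => by
      dsimp only
      split_ifs with hiT
      · rfl
      · exact hcT i fun hi' => hi (himpl i (htight.1 hi') hiT), by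
      ext j
      have h1 := congrFun hw j
      simp only [Finset.sum_apply, Pi.smul_apply, smul_eq_mul] at h1
      have h2 : ∑ i ∈ T, (q i : ℝ) * (M i j : ℝ) = ∑ i, if i ∈ T then c i * rowR M i j else 0 := by
        rw [Finset.sum_ite_mem, Finset.univ_inter]
        exact Finset.sum_congr rfl fun i hi => by rw [hq i hi]; rfl
      simp only [Pi.sub_apply, Finset.sum_apply, Pi.smul_apply, smul_eq_mul]
      push_cast
      rw [h2, ← h1, ← Finset.sum_sub_distrib]
      exact Finset.sum_congr rfl fun i _ => by split_ifs <;> simp⟩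
  refine ⟨fun i => k i + if i ∈ T then q i else 0, fun i hi => ?_, ?_⟩
  · have : i ∉ T := fun hiT => hi (htight.2 (Finset.mem_filter.1 hiT).2.1)
    simp [this, hk i fun hi' => hi (hsub hi')]
  · have : ∑ i, ((if i ∈ T then q i else 0 : ℕ) : ℤ) • M i = ∑ i ∈ T, (q i : ℤ) • M i := by
      rw [← Finset.sum_subset (Finset.subset_univ T) fun i _ hi => by simp [hi]]
      exact Finset.sum_congr rfl fun i hi => by simp [hi]
    simp only [Nat.cast_add, add_smul, Finset.sum_add_distrib]
    rw [hkw, this, sub_add_cancel]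

/-- If the rows tight at every basic point form a Hilbert cone, the system is totally dual
integral. -/
theorem isTDI_of_forall_isHilbertCone_tightSet {m n : ℕ} {M : Matrix (Fin m) (Fin n) ℤ}
    {b : Fin m → ℤ}
    (h : ∀ y, IsBasicPoint M b y → IsHilbertCone (fun i : tightSet M b {y} => M i)) :
    IsTDI M b := by
  classical
  rintro w ⟨⟨x, hx, hmax⟩, -⟩
  obtain ⟨y, hy, hyw⟩ := exists_isBasicPoint hx hmax
  have hmax' : ∀ x' ∈ polyhedron M b, (fun j => (w j : ℝ)) ⬝ᵥ x' ≤ (fun j => (w j : ℝ)) ⬝ᵥ y :=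
    fun x' hx' => (hmax x' hx').trans hyw.ge
  obtain ⟨c, hc, hcw⟩ := exists_nonneg_combination_of_dotProduct_nonpos (tightSet M b {y})
    (rowR M) (fun j => (w j : ℝ)) fun d hd => dotProduct_nonpos_of_isMaxOn hy.1 hmax'
      fun i hi => hd i (mem_tightSet.2 (by simpa using hi))
  obtain ⟨k, hk, hkw⟩ := isHilbertCone_subtype_iff.1 (h y hy) w
    ⟨fun i => if i ∈ tightSet M b {y} then c i else 0, fun i => by
      dsimp only
      split_ifs
      · exact hc i
      · exact le_rfl, fun i hi => if_neg hi, by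
      rw [← hcw, ← Finset.sum_subset (Finset.subset_univ (tightSet M b {y}))
        fun i _ hi => by simp [hi]]
      exact Finset.sum_congr rfl fun i hi => by simp only [if_pos hi]⟩
  refine ⟨fun i => k i, isDualOptimal_of_complementary hy.1 ⟨fun i => by simp, ?_⟩ fun i hi => ?_⟩
  · ext j
    simp [← hkw, rowR, Finset.sum_apply]
  · have := hk i fun hi' => hi (mem_tightSet.1 hi' y rfl)
    simp [this]

/-- A linear form constant on a set that affinely spans the space is zero, so every implicit
equality has a zero row and the cone is trivial. -/
theorem isHilbertCone_implicitEqualities_of_affineSpan_eq_top {m n : ℕ}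
    {M : Matrix (Fin m) (Fin n) ℤ} {b : Fin m → ℤ} (h : affineSpan ℝ (polyhedron M b) = ⊤) :
    IsHilbertCone (fun i : implicitEqualities M b => M i) := by
  have hzero : ∀ i ∈ implicitEqualities M b, M i = 0 := by
    intro i hi
    let f : (Fin n → ℝ) →ᵃ[ℝ] ℝ := (dotProductBilin ℝ ℝ (rowR M i)).toAffineMap
    have hf : f = AffineMap.const ℝ (Fin n → ℝ) (b i : ℝ) := by
      refine AffineMap.ext_on h fun x hx => ?_
      exact mem_tightSet.1 hi x hx
    have hval : ∀ x, rowR M i ⬝ᵥ x = b i := fun x => congrArg (fun g => g x) hf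
    have h0 : (b i : ℝ) = 0 := by rw [← hval 0, dotProduct_zero]
    have h1 : rowR M i = 0 := dotProduct_self_eq_zero.1 ((hval _).trans h0)
    ext j
    have := congrFun h1 j
    simpa [rowR] using this
  rintro w ⟨c, -, hw⟩
  refine ⟨0, fun j => ?_⟩
  have : (w j : ℝ) = 0 := by
    rw [hw]
    exact Finset.sum_eq_zero fun i _ => by simp [hzero i i.2]
  simpa using this

/-- A non-degenerate integral system `M x ≤ b` with a solution is TDI if and only if the rows of
its implicit equalities form a Hilbert cone and it is resilient; if the polyhedron is
full-dimensional, it is TDI if and only if it is resilient. -/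
theorem mainTheorem2 {m n : ℕ} (M : Matrix (Fin m) (Fin n) ℤ) (b : Fin m → ℤ)
    (hne : (polyhedron M b).Nonempty) (hnd : IsNonDegenerate M b) :
    (IsTDI M b ↔
      IsHilbertCone (fun i : implicitEqualities M b => M i) ∧ IsResilient M b) ∧
    (affineSpan ℝ (polyhedron M b) = ⊤ → (IsTDI M b ↔ IsResilient M b)) := by
  have key : IsTDI M b ↔
      IsHilbertCone (fun i : implicitEqualities M b => M i) ∧ IsResilient M b :=
    ⟨fun h => ⟨h.isHilbertCone_tightSet hne subset_rfl, h.isResilient hnd⟩, fun h =>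
      isTDI_of_forall_isHilbertCone_tightSet fun _ hy =>
        h.2.isHilbertCone_tightSet_singleton hnd h.1 hy⟩
  exact ⟨key, fun h => key.trans
    (and_iff_right (isHilbertCone_implicitEqualities_of_affineSpan_eq_top h))⟩
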